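/- Let $\mathbb{F}_q$ be a finite field with $q$ elements, $K=\mathbb{F}_q(\theta)$ the field of rational functions in the indeterminate $\theta$, and $d\ge 1$ an integer. For $b\in K$ put $b^{(k)}=b^{q^k}$, and for a matrix $M$ over $K$ let $M^{(k)}$ be the matrix obtained by raising all its entries to the power $q^k$. Set $[0]=1$ and $[m]=\theta^{q^m}-\theta$ for $m\ge 1$; $l_0=1$ and $l_i=(\theta-\theta^{q^i})\,l_{i-1}$ for $i\ge1$; $D_0=1$ and $D_i=[i]\,D_{i-1}^q$ for $i\ge 1$; and $$f_d(x,y,z)=\frac{(z-y)^d-(x-y)^d}{z-x}=\sum_{j=0}^{d-1}(z-y)^j(x-y)^{d-1-j}.$$ Let $x,y,z$ be independent indeterminates, let $\mathcal{D}_{x,n}$ and $\mathcal{D}_{z,n}$ $(n\ge 0)$ denote the higher divided (Hasse) derivatives on $K(x,y,z)$ with respect to $x$ and to $z$, and for $f\in K(x,y,z)$ let $$\boldsymbol{\Delta}_{x,z}(f)=\Big(\mathcal{D}_{x,d-i}\big(\mathcal{D}_{z,j-1}(f)\big)\Big)_{1\le i,j\le d}.$$ For $i\ge 0$ define the matrix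 $$\mathcal{L}_i=\boldsymbol{\Delta}_{x,z}\left(f_d(x,y,z)\Big(\frac{(x-\theta^q)\cdots(x-\theta^{q^i})}{(z-\theta^{q^2})\cdots(z-\theta^{q^{i+1}})}\Big)^d\right)_{x=\theta,\ y=\theta^{q^{i+1}},\ z=\theta^q}\in K^{d\times d},$$ and for $i\ge0$, $j\ge 1$ the scalar $$\lambda_{i,j}=[j-1]^{(1-d)q}\,l_i^{d(1-q)}\,f_d\big(\theta,\theta^{q^{i+1}},\theta^{q^j}\big)\in K.$$ For $k\ge m\ge 1$ put $$\mathcal{L}_{<k}(m)=\sum_{k>i_1>\cdots>i_m\ge0}\mathcal{L}_{i_1}\mathcal{L}_{i_2}^{(1)}\cdots\mathcal{L}_{i_m}^{(m-1)},\qquad \lambda_{<k}(m)=\sum_{k>i_1>\cdots>i_m\ge0}\lambda_{i_1,m}\,\lambda_{i_2,m-1}^{q}\cdots\lambda_{i_m,1}^{q^{m-1}}.$$ Then, for all $k\ge m\ge1$, the entry of $\mathcal{L}_{<k}(m)$ in row $d$ and column $1$ satisfies $$[\mathcal{L}_{<k}(m)]_{d,1}=\lambda_{<k}(m)=(-1)^m\,l_k^{d}\,[m]^{d-1}\,D_m^{-d}\,l_{k-m}^{-dq^m}.$$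 -/

import Mathlib

namespace CarlitzTensor

noncomputable section

/-! ### Rational functions in several variables, divided derivatives, evaluation -/

/-- The field `F(x_s : s ∈ σ)` of rational functions in the independent indeterminates `x_s`. -/
abbrev MvRat (σ : Type*) (F : Type*) [Field F] : Type _ := FractionRing (MvPolynomial σ F)

/-- The indeterminate `x_v`, as a rational function. -/
def ratX {σ F : Type*} [Field F] (v : σ) : MvRat σ F :=
  algebraMap (MvPolynomial σ F) (MvRat σ F) (MvPolynomial.X v)

/-- A constant `c ∈ F`, as a rational function. -/
def ratC {σ F : Type*} [Field F] (c : F) : MvRat σ F :=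
  algebraMap (MvPolynomial σ F) (MvRat σ F) (MvPolynomial.C c)

/-- The substitution `x_v ↦ x_v + T` (the other indeterminates are fixed), from polynomials to
power series in `T` with coefficients in the field of rational functions. -/
def taylorPoly {σ F : Type*} [Field F] [DecidableEq σ] (v : σ) :
    MvPolynomial σ F →+* PowerSeries (MvRat σ F) :=
  MvPolynomial.eval₂Hom ((PowerSeries.C (R := MvRat σ F)).comp
      ((algebraMap (MvPolynomial σ F) (MvRat σ F)).comp MvPolynomial.C))
    (fun w => PowerSeries.C (ratX w) + if w = v then PowerSeries.X else 0)

theorem constantCoeff_taylorPoly {σ F : Type*} [Field F] [DecidableEq σ] (v : σ)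
    (f : MvPolynomial σ F) :
    PowerSeries.constantCoeff (taylorPoly v f) =
      algebraMap (MvPolynomial σ F) (MvRat σ F) f := by
  have h : (PowerSeries.constantCoeff (R := MvRat σ F)).comp (taylorPoly v) =
      algebraMap (MvPolynomial σ F) (MvRat σ F) := by
    apply MvPolynomial.ringHom_ext
    · intro r
      simp [taylorPoly]
    · intro w
      by_cases hw : w = v <;> simp [taylorPoly, ratX, hw]
  exact RingHom.congr_fun h f

theorem isUnit_taylorPoly {σ F : Type*} [Field F] [DecidableEq σ] (v : σ)
    (s : nonZeroDivisors (MvPolynomial σ F)) : IsUnit (taylorPoly v (s : MvPolynomial σ F)) := by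
  rw [PowerSeries.isUnit_iff_constantCoeff, constantCoeff_taylorPoly]
  exact IsLocalization.map_units (MvRat σ F) s

/-- The Taylor homomorphism `F(x_s) → F(x_s)[[T]]`, `f ↦ f|_{x_v ↦ x_v + T}`. -/
def taylor {σ F : Type*} [Field F] [DecidableEq σ] (v : σ) :
    MvRat σ F →+* PowerSeries (MvRat σ F) :=
  IsLocalization.lift (M := nonZeroDivisors (MvPolynomial σ F)) (g := taylorPoly v)
    (isUnit_taylorPoly v)

/-- The `n`-th higher divided derivative `𝒟_{x_v, n}` on `F(x_s)`: the coefficient of `T ^ n` in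
the Taylor expansion `f|_{x_v ↦ x_v + T} = ∑ 𝒟_{x_v, n}(f) T ^ n`. -/
def dividedDeriv {σ F : Type*} [Field F] [DecidableEq σ] (v : σ) (n : ℕ) (f : MvRat σ F) :
    MvRat σ F :=
  PowerSeries.coeff n (taylor v f)

/-- The value of the rational function `f` at the point `a`, computed from the reduced fraction
representing `f` (meaningful when `f` is regular at `a`, see `evalAt_div`). -/
def evalAt {σ F : Type*} [Field F] (a : σ → F) (f : MvRat σ F) : F :=
  MvPolynomial.eval a (IsFractionRing.num (MvPolynomial σ F) f) /
    MvPolynomial.eval a (IsFractionRing.den (MvPolynomial σ F) f : MvPolynomial σ F)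

theorem evalAt_div {σ F : Type*} [Field F] (a : σ → F) (p s : MvPolynomial σ F)
    (hs : MvPolynomial.eval a s ≠ 0) :
    evalAt a (algebraMap (MvPolynomial σ F) (MvRat σ F) p /
      algebraMap (MvPolynomial σ F) (MvRat σ F) s) =
    MvPolynomial.eval a p / MvPolynomial.eval a s := by
  set f : MvRat σ F := algebraMap (MvPolynomial σ F) (MvRat σ F) p /
      algebraMap (MvPolynomial σ F) (MvRat σ F) s with hf
  have inj := IsFractionRing.injective (MvPolynomial σ F) (MvRat σ F)
  have hs0 : s ≠ 0 := by rintro rfl; simp at hs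
  have hs1 : algebraMap (MvPolynomial σ F) (MvRat σ F) s ≠ 0 := by
    simpa using inj.ne hs0
  have hd1 : algebraMap (MvPolynomial σ F) (MvRat σ F)
      (IsFractionRing.den (MvPolynomial σ F) f : MvPolynomial σ F) ≠ 0 :=
    (IsLocalization.map_units (MvRat σ F) (IsFractionRing.den (MvPolynomial σ F) f)).ne_zero
  have e1 : algebraMap (MvPolynomial σ F) (MvRat σ F) (IsFractionRing.num (MvPolynomial σ F) f) /
      algebraMap (MvPolynomial σ F) (MvRat σ F)
        (IsFractionRing.den (MvPolynomial σ F) f : MvPolynomial σ F) = f := by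
    have := IsFractionRing.mk'_num_den (MvPolynomial σ F) f
    rwa [IsFractionRing.mk'_eq_div] at this
  have e2 : IsFractionRing.num (MvPolynomial σ F) f * s =
      p * (IsFractionRing.den (MvPolynomial σ F) f : MvPolynomial σ F) := by
    apply inj
    rw [map_mul, map_mul]
    exact (div_eq_div_iff hd1 hs1).1 (e1.trans hf)
  have hdvd : (IsFractionRing.den (MvPolynomial σ F) f : MvPolynomial σ F) ∣ s := by
    have hrel := IsFractionRing.num_den_reduced (MvPolynomial σ F) f
    exact hrel.symm.dvd_of_dvd_mul_left ⟨p, by rw [e2, mul_comm]⟩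
  have hd : MvPolynomial.eval a
      (IsFractionRing.den (MvPolynomial σ F) f : MvPolynomial σ F) ≠ 0 := by
    obtain ⟨c, hc⟩ := hdvd
    intro h0
    apply hs
    rw [hc, map_mul, h0, zero_mul]
  unfold evalAt
  rw [div_eq_div_iff hd hs, ← map_mul, e2, map_mul]

/-- The matrix `Δ_{x,z}(f)` of size `d`, for the indeterminates `x = x_v` and `z = x_w`.
With rows and columns numbered from `1`, its `(i, j)` entry is `𝒟_{x, d-i}(𝒟_{z, j-1}(f))`. -/
def deltaMatrix {σ F : Type*} [Field F] [DecidableEq σ] (d : ℕ) (v w : σ) (f : MvRat σ F) :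
    Matrix (Fin d) (Fin d) (MvRat σ F) :=
  Matrix.of fun i j => dividedDeriv v (d - 1 - (i : ℕ)) (dividedDeriv w (j : ℕ) f)

/-- The polynomial `f_d(x, y, z) = ((z - y) ^ d - (x - y) ^ d) / (z - x)`, written as
`∑_{j < d} (z - y) ^ j (x - y) ^ (d - 1 - j)`. -/
def fPoly {R : Type*} [CommRing R] (d : ℕ) (x y z : R) : R :=
  ∑ j ∈ Finset.range d, (z - y) ^ j * (x - y) ^ (d - 1 - j)

theorem fPoly_mul {R : Type*} [CommRing R] (d : ℕ) (x y z : R) :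
    fPoly d x y z * (z - x) = (z - y) ^ d - (x - y) ^ d := by
  have h := (Commute.all (z - y) (x - y)).geom_sum₂_mul d
  rwa [sub_sub_sub_cancel_right] at h

/-! ### The Carlitz setting: `K = 𝔽_q(θ)` -/

/-- The indeterminate `θ` of `K = 𝔽_q(θ)`. -/
def theta (Fq : Type*) [Field Fq] : RatFunc Fq := RatFunc.X

/-- `[m] = θ ^ (q ^ m) - θ` for `m > 0`, and `[0] = 1`. -/
def bracket (Fq : Type*) [Field Fq] (q m : ℕ) : RatFunc Fq :=
  if m = 0 then 1 else theta Fq ^ q ^ m - theta Fq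

/-- `l_0 = 1` and `l_i = (θ - θ ^ (q ^ i)) l_{i-1}`. -/
def carlitzL (Fq : Type*) [Field Fq] (q : ℕ) : ℕ → RatFunc Fq
  | 0 => 1
  | i + 1 => (theta Fq - theta Fq ^ q ^ (i + 1)) * carlitzL Fq q i

/-- `D_0 = 1` and `D_i = [i] D_{i-1} ^ q`, that is `D_m = [m] [m-1] ^ q ⋯ [1] ^ (q ^ (m-1))`. -/
def carlitzD (Fq : Type*) [Field Fq] (q : ℕ) : ℕ → RatFunc Fq
  | 0 => 1
  | i + 1 => bracket Fq q (i + 1) * carlitzD Fq q i ^ q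

/-- The `k`-th twist `M^{(k)}`: the `q ^ k`-power map applied to all entries of `M`. -/
def twist {Fq : Type*} [Field Fq] (q k : ℕ) {d : ℕ} (M : Matrix (Fin d) (Fin d) (RatFunc Fq)) :
    Matrix (Fin d) (Fin d) (RatFunc Fq) :=
  M.map fun b => b ^ q ^ k

/-- The rational function
`f_d(x,y,z) (((x-θ^q)⋯(x-θ^(q^i))) / ((z-θ^(q^2))⋯(z-θ^(q^(i+1))))) ^ d` in `K(x, y, z)`,
where `x`, `y`, `z` are the indeterminates of index `0`, `1`, `2`. -/
def rootL (Fq : Type*) [Field Fq] (q d i : ℕ) : MvRat (Fin 3) (RatFunc Fq) :=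
  fPoly d (ratX 0) (ratX 1) (ratX 2) *
    ((∏ s ∈ Finset.Icc 1 i, (ratX 0 - ratC (theta Fq ^ q ^ s))) /
      (∏ s ∈ Finset.Icc 1 i, (ratX 2 - ratC (theta Fq ^ q ^ (s + 1))))) ^ d

/-- The matrix `𝓛_i`: the matrix `Δ_{x,z}` of `rootL`, evaluated at
`x = θ`, `y = θ ^ (q ^ (i+1))`, `z = θ ^ q`. -/
def matL (Fq : Type*) [Field Fq] (q d i : ℕ) : Matrix (Fin d) (Fin d) (RatFunc Fq) :=
  (deltaMatrix d 0 2 (rootL Fq q d i)).map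
    (evalAt ![theta Fq, theta Fq ^ q ^ (i + 1), theta Fq ^ q])

/-- The set of index tuples `k > i_1 > i_2 > ⋯ > i_m ≥ 0`; the index `i_{r+1}` is `i r`. -/
def decreasingTuples (k m : ℕ) : Finset (Fin m → Fin k) :=
  open Classical in Finset.univ.filter fun i => StrictAnti i

/-- The matrix multiple sum
`𝓛_{<k}(m) = ∑_{k > i_1 > ⋯ > i_m ≥ 0} 𝓛_{i_1} 𝓛_{i_2}^{(1)} ⋯ 𝓛_{i_m}^{(m-1)}`. -/
def matMultiSum (Fq : Type*) [Field Fq] (q d k m : ℕ) : Matrix (Fin d) (Fin d) (RatFunc Fq) :=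
  ∑ i ∈ decreasingTuples k m,
    (List.ofFn fun r : Fin m => twist q (r : ℕ) (matL Fq q d (i r : ℕ))).prod

/-- `λ_{i,j} = [j-1] ^ ((1-d) q) l_i ^ (d (1-q)) f_d(θ, θ ^ (q ^ (i+1)), θ ^ (q ^ j))`
for `i ≥ 0` and `j ≥ 1`. -/
def lam (Fq : Type*) [Field Fq] (q d i j : ℕ) : RatFunc Fq :=
  bracket Fq q (j - 1) ^ ((1 - (d : ℤ)) * (q : ℤ)) * carlitzL Fq q i ^ ((d : ℤ) * (1 - (q : ℤ))) *
    fPoly d (theta Fq) (theta Fq ^ q ^ (i + 1)) (theta Fq ^ q ^ j)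

/-- The scalar multiple sum
`λ_{<k}(m) = ∑_{k > i_1 > ⋯ > i_m ≥ 0} λ_{i_1,m} λ_{i_2,m-1} ^ q ⋯ λ_{i_m,1} ^ (q ^ (m-1))`. -/
def lamMultiSum (Fq : Type*) [Field Fq] (q d k m : ℕ) : RatFunc Fq :=
  ∑ i ∈ decreasingTuples k m, ∏ r : Fin m, lam Fq q d (i r : ℕ) (m - (r : ℕ)) ^ q ^ (r : ℕ)

end

end CarlitzTensor

namespace CarlitzTensor

noncomputable section

/-! ### Divided derivatives at a point -/

section Regular

variable {σ F : Type*} [Field F]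

/-! Write `b_{k,m}` for `sumCoeff` and `P_k(x) = ∏_{s=1}^k (x - θ^(q^s))^d`. Both multiple sums are
governed by one function of `x`, `S_{m,k}(x) = ∑_{i<k} b_{i,m}^q f_d(x, θ^(q^(i+1)), θ^(q^(m+1)))
P_i(x)`. By the defining property of `f_d` the sum telescopes: `(θ^(q^(m+1)) - x) S_{m,k}(x) =
b_{k,m+1} [m+1]^d P_k(x)` (`sub_mul_sum_summand`).

Scalar side: splitting off the largest index and inducting on the depth gives `λ_{<k}(m+1) =
S_{m,k}(θ)`, and the telescoped form at `x = θ` is the closed formula (`lamMultiSum_eq`).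

Matrix side: the first column of `𝓛_{<k}(m+1)` lists, from bottom to top, the first `d` Taylor
coefficients of `S_{m,k}` at `θ` (`matMultiSum_succ_apply`). In the induction, multiplying `𝓛_i` by
the twisted column extracts the coefficient of `T^(d-1)` from a product of series in `T = z - θ^q`.
The factor `P_i^{(1)}` of the twisted sum cancels the denominator of `𝓛_i`, leaving `f_d(x, y, θ^q +
T) / (c - T)` up to factors free of `T`. As `f_d` has degree below `d` in `z`, that coefficient is
the value of `f_d` at `T = c`, divided by `c^d` (`sum_matL_mul_frob`). The bottom entry is then
`S_{m,k}(θ)`. -/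

/-- The polynomials that do not vanish at `a`. -/
def nonvanishing (a : σ → F) : Submonoid (MvPolynomial σ F) where
  carrier := {s | MvPolynomial.eval a s ≠ 0}
  one_mem' := by simp
  mul_mem' := by
    intro s t hs ht
    simpa using ⟨hs, ht⟩

theorem nonvanishing_le (a : σ → F) : nonvanishing a ≤ nonZeroDivisors (MvPolynomial σ F) := by
  intro s hs
  rw [mem_nonZeroDivisors_iff_ne_zero]
  rintro rfl
  exact hs (map_zero _)

/-- The ring of fractions regular at `a`. -/
abbrev LocalRingAt (a : σ → F) : Type _ := Localization (nonvanishing a)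

/-- The inclusion of the fractions regular at `a` into all rational functions. -/
def toRat (a : σ → F) : LocalRingAt a →+* MvRat σ F :=
  IsLocalization.lift (M := nonvanishing a) (g := algebraMap (MvPolynomial σ F) (MvRat σ F))
    fun s => IsLocalization.map_units (MvRat σ F)
      (⟨s, nonvanishing_le a s.2⟩ : nonZeroDivisors (MvPolynomial σ F))

@[simp]
theorem toRat_algebraMap (a : σ → F) (p : MvPolynomial σ F) :
    toRat a (algebraMap _ _ p) = algebraMap (MvPolynomial σ F) (MvRat σ F) p :=
  IsLocalization.lift_eq _ _

/-- The value at `a` of a fraction regular at `a`. -/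
def localEval (a : σ → F) : LocalRingAt a →+* F :=
  IsLocalization.lift (M := nonvanishing a) (g := MvPolynomial.eval a)
    fun s => isUnit_iff_ne_zero.2 s.2

@[simp]
theorem localEval_algebraMap (a : σ → F) (p : MvPolynomial σ F) :
    localEval a (algebraMap _ _ p) = MvPolynomial.eval a p :=
  IsLocalization.lift_eq _ _

theorem exists_fraction (a : σ → F) (r : LocalRingAt a) :
    ∃ p s : MvPolynomial σ F, MvPolynomial.eval a s ≠ 0 ∧
      r * algebraMap _ _ s = algebraMap _ _ p := by
  obtain ⟨⟨p, s⟩, h⟩ := IsLocalization.surj (nonvanishing a) r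
  exact ⟨p, s, s.2, h⟩

theorem evalAt_toRat (a : σ → F) (r : LocalRingAt a) : evalAt a (toRat a r) = localEval a r := by
  obtain ⟨p, s, hs, h⟩ := exists_fraction a r
  have h1 := congrArg (toRat a) h
  have h2 := congrArg (localEval a) h
  simp only [map_mul, toRat_algebraMap, localEval_algebraMap] at h1 h2
  have hs1 : algebraMap (MvPolynomial σ F) (MvRat σ F) s ≠ 0 :=
    (IsLocalization.map_units (MvRat σ F)
      (⟨s, nonvanishing_le a hs⟩ : nonZeroDivisors (MvPolynomial σ F))).ne_zero
  rw [eq_div_of_mul_eq hs1 h1, evalAt_div a p s hs, eq_div_of_mul_eq hs h2]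

variable [DecidableEq σ]

/-- The Taylor substitution `x_v ↦ x_v + T` on polynomials, with values in power series over the
fractions regular at `a`. -/
def localTaylorPoly (a : σ → F) (v : σ) : MvPolynomial σ F →+* PowerSeries (LocalRingAt a) :=
  MvPolynomial.eval₂Hom ((PowerSeries.C (R := LocalRingAt a)).comp
      ((algebraMap (MvPolynomial σ F) (LocalRingAt a)).comp MvPolynomial.C))
    (fun w => PowerSeries.C (algebraMap (MvPolynomial σ F) (LocalRingAt a) (MvPolynomial.X w)) +
      if w = v then PowerSeries.X else 0)

theorem constantCoeff_localTaylorPoly (a : σ → F) (v : σ) (f : MvPolynomial σ F) :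
    PowerSeries.constantCoeff (localTaylorPoly a v f) =
      algebraMap (MvPolynomial σ F) (LocalRingAt a) f := by
  have h : (PowerSeries.constantCoeff (R := LocalRingAt a)).comp (localTaylorPoly a v) =
      algebraMap (MvPolynomial σ F) (LocalRingAt a) := by
    apply MvPolynomial.ringHom_ext
    · intro r
      simp [localTaylorPoly]
    · intro w
      by_cases hw : w = v <;> simp [localTaylorPoly, hw]
  exact RingHom.congr_fun h f

/-- The Taylor homomorphism on the fractions regular at `a`. -/
def localTaylor (a : σ → F) (v : σ) : LocalRingAt a →+* PowerSeries (LocalRingAt a) :=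
  IsLocalization.lift (M := nonvanishing a) (g := localTaylorPoly a v) fun s => by
    rw [PowerSeries.isUnit_iff_constantCoeff, constantCoeff_localTaylorPoly]
    exact IsLocalization.map_units (LocalRingAt a) s

@[simp]
theorem localTaylor_algebraMap (a : σ → F) (v : σ) (p : MvPolynomial σ F) :
    localTaylor a v (algebraMap _ _ p) = localTaylorPoly a v p :=
  IsLocalization.lift_eq _ _

theorem taylor_algebraMap (v : σ) (p : MvPolynomial σ F) :
    taylor v (algebraMap _ _ p) = taylorPoly v p :=
  IsLocalization.lift_eq _ _

/-- Divided derivatives preserve regularity at `a`, so evaluation can be done by a ring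
homomorphism, which `evalAt` on all rational functions is not. -/
theorem taylor_toRat (a : σ → F) (v : σ) (r : LocalRingAt a) :
    taylor v (toRat a r) = PowerSeries.map (toRat a) (localTaylor a v r) := by
  have h : (taylor v).comp (toRat a) = (PowerSeries.map (toRat a)).comp (localTaylor a v) := by
    apply IsLocalization.ringHom_ext (nonvanishing a)
    apply MvPolynomial.ringHom_ext
    · intro c
      simp [taylor_algebraMap, taylorPoly, localTaylorPoly]
    · intro w
      by_cases hw : w = v <;> simp [taylor_algebraMap, taylorPoly, localTaylorPoly, hw, ratX]
  exact RingHom.congr_fun h r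

/-- The double Taylor expansion of polynomials at `a`: the substitution `x_v ↦ a_v + X`,
`x_w ↦ a_w + T`, and `x_u ↦ a_u` for the other indeterminates. -/
def expandAt (a : σ → F) (v w : σ) : MvPolynomial σ F →+* PowerSeries (PowerSeries F) :=
  MvPolynomial.eval₂Hom ((PowerSeries.C (R := PowerSeries F)).comp PowerSeries.C)
    (fun u => PowerSeries.C (PowerSeries.C (a u) + if u = v then PowerSeries.X else 0) +
      if u = w then PowerSeries.X else 0)

/-- The values at `a` of the mixed divided derivatives of a quotient regular at `a` are the
coefficients of its double Taylor expansion. -/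
theorem exists_expansion (a : σ → F) (v w : σ) (p s : MvPolynomial σ F)
    (hs : MvPolynomial.eval a s ≠ 0) :
    ∃ Φ : PowerSeries (PowerSeries F), Φ * expandAt a v w s = expandAt a v w p ∧
      ∀ m n, evalAt a (dividedDeriv v m (dividedDeriv w n
        (algebraMap (MvPolynomial σ F) (MvRat σ F) p /
          algebraMap (MvPolynomial σ F) (MvRat σ F) s))) =
        PowerSeries.coeff m (PowerSeries.coeff n Φ) := by
  -- The outer variable records the derivatives in `w`, taken first; each coefficient is then
  -- expanded in `v` and evaluated at `a`.
  let ψ : LocalRingAt a →+* PowerSeries (PowerSeries F) :=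
    (PowerSeries.map ((PowerSeries.map (localEval a)).comp (localTaylor a v))).comp
      (localTaylor a w)
  have hψ : ψ.comp (algebraMap _ _) = expandAt a v w := by
    apply MvPolynomial.ringHom_ext
    · intro c
      simp [ψ, localTaylorPoly, expandAt]
    · intro u
      obtain rfl | hv := eq_or_ne u v <;> obtain rfl | hw := eq_or_ne u w <;>
        simp [ψ, localTaylorPoly, expandAt, *]
  have hψ' : ∀ p, ψ (algebraMap _ _ p) = expandAt a v w p := RingHom.congr_fun hψ
  let r : LocalRingAt a := IsLocalization.mk' _ p (⟨s, hs⟩ : nonvanishing a)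
  have hr : r * algebraMap _ _ s = algebraMap _ _ p :=
    IsLocalization.mk'_spec _ p (⟨s, hs⟩ : nonvanishing a)
  have hs1 : algebraMap (MvPolynomial σ F) (MvRat σ F) s ≠ 0 :=
    (IsLocalization.map_units (MvRat σ F)
      (⟨s, nonvanishing_le a hs⟩ : nonZeroDivisors (MvPolynomial σ F))).ne_zero
  have h1 := congrArg (toRat a) hr
  simp only [map_mul, toRat_algebraMap] at h1
  refine ⟨ψ r, ?_, fun m n => ?_⟩
  · rw [← hψ', ← hψ', ← map_mul, hr]
  · rw [← eq_div_of_mul_eq hs1 h1]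
    simp only [dividedDeriv, taylor_toRat, PowerSeries.coeff_map, evalAt_toRat]
    simp [ψ]

end Regular

/-! ### Multiple sums -/

theorem mem_decreasingTuples {k m : ℕ} {i : Fin m → Fin k} :
    i ∈ decreasingTuples k m ↔ StrictAnti i := by
  simp [decreasingTuples]

theorem sum_decreasingTuples_zero {M : Type*} [AddCommMonoid M] (k : ℕ) (g : (Fin 0 → ℕ) → M) :
    ∑ i ∈ decreasingTuples k 0, g (fun r => i r) = g Fin.elim0 := by
  have : decreasingTuples k 0 = {Fin.elim0} := by
    ext i
    simp only [mem_decreasingTuples, Finset.mem_singleton]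
    exact ⟨fun _ => Subsingleton.elim _ _, fun _ r => r.elim0⟩
  rw [this, Finset.sum_singleton]
  exact congrArg g (Subsingleton.elim _ _)

/-- Splitting off the largest index of a multiple sum. -/
theorem sum_decreasingTuples_succ {M : Type*} [AddCommMonoid M] (k m : ℕ)
    (g : (Fin (m + 1) → ℕ) → M) :
    ∑ i ∈ decreasingTuples k (m + 1), g (fun r => i r) =
      ∑ n ∈ Finset.range k, ∑ j ∈ decreasingTuples n m,
        g (Fin.cons (α := fun _ => ℕ) n (fun r => (j r : ℕ))) := by
  rw [Finset.sum_range, Finset.sum_sigma']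
  symm
  refine Finset.sum_bij
    (fun x _ => Fin.cons (α := fun _ => Fin k) x.1 (fun r => (x.2 r).castLE x.1.2.le)) ?_ ?_ ?_ ?_
  · rintro ⟨n, j⟩ h
    simp only [Finset.mem_sigma, Finset.mem_univ, true_and, mem_decreasingTuples] at h ⊢
    intro r s hrs
    induction s using Fin.cases with
    | zero => exact absurd hrs (Fin.not_lt_zero r)
    | succ s =>
      induction r using Fin.cases with
      | zero => exact (j s).2
      | succ r => exact h (Fin.succ_lt_succ_iff.1 hrs)
  · rintro ⟨n, j⟩ _ ⟨n', j'⟩ _ h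
    rw [Fin.cons_inj] at h
    obtain ⟨rfl, h⟩ := h
    have : j = j' := by
      funext r
      exact Fin.castLE_injective _ (congrFun h r)
    rw [this]
  · intro i hi
    rw [mem_decreasingTuples] at hi
    refine ⟨⟨i 0, fun r => ⟨i r.succ, hi (Fin.succ_pos r)⟩⟩, ?_, ?_⟩
    · simp only [Finset.mem_sigma, Finset.mem_univ, true_and, mem_decreasingTuples]
      intro r s hrs
      exact hi (Fin.succ_lt_succ_iff.2 hrs)
    · funext r
      induction r using Fin.cases with
      | zero => rfl
      | succ r => rfl
  · rintro ⟨n, j⟩ _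
    congr 1
    funext r
    induction r using Fin.cases with
    | zero => rfl
    | succ r => rfl

/-! ### Power series, the Carlitz factorials and the scalar sum -/

section PowerSeriesLemmas

/-- Division of a power series by `c - T`. -/
theorem coeff_of_mul_sub_X {R : Type*} [CommRing R] {Q P : PowerSeries R} {c : R}
    (h : Q * (PowerSeries.C c - PowerSeries.X) = P) (n : ℕ) :
    c ^ (n + 1) * PowerSeries.coeff n Q =
      ∑ j ∈ Finset.range (n + 1), PowerSeries.coeff j P * c ^ j := by
  subst h
  induction n with
  | zero => simp [mul_sub, mul_comm]
  | succ n ih =>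
    rw [Finset.sum_range_succ, ← ih, mul_sub, map_sub, PowerSeries.coeff_succ_mul_X,
      PowerSeries.coeff_mul_C]
    ring

theorem map_fPoly {R S : Type*} [CommRing R] [CommRing S] (φ : R →+* S) (d : ℕ) (x y z : R) :
    φ (fPoly d x y z) = fPoly d (φ x) (φ y) (φ z) := by
  simp [fPoly]

open Polynomial in
/-- Extracting `f_d(x, y, t + c)` from the expansion of `f_d(x, y, t + T) / (c - T)`. -/
theorem coeff_of_mul_sub_X_eq_fPoly {R : Type*} [CommRing R] {d : ℕ} (hd : 1 ≤ d)
    {Q : PowerSeries R} {c x y t e : R}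
    (h : Q * (PowerSeries.C c - PowerSeries.X) = PowerSeries.C e *
      fPoly d (PowerSeries.C x) (PowerSeries.C y) (PowerSeries.C t + PowerSeries.X)) :
    c ^ d * PowerSeries.coeff (d - 1) Q = e * fPoly d x y (t + c) := by
  obtain ⟨n, rfl⟩ : ∃ n, d = n + 1 := ⟨d - 1, by omega⟩
  let p : R[X] := fPoly (n + 1) (C x) (C y) (C t + X)
  have hp : (p : PowerSeries R) = fPoly (n + 1) (PowerSeries.C x) (PowerSeries.C y)
      (PowerSeries.C t + PowerSeries.X) := by
    rw [← Polynomial.coeToPowerSeries.ringHom_apply]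
    simp only [p, map_fPoly]
    simp
  have hdeg : p.natDegree < n + 1 := by
    refine Nat.lt_succ_of_le (natDegree_sum_le_of_forall_le _ _ fun j hj => ?_)
    rw [← C_sub, ← C_pow]
    refine natDegree_mul_C_le _ _ |>.trans ?_
    refine (natDegree_pow_le_of_le j (m := 1) ?_).trans ?_
    · rw [add_sub_right_comm, ← C_sub, add_comm, natDegree_add_C]
      exact natDegree_X_le
    · have := Finset.mem_range.1 hj
      omega
  rw [← hp] at h
  -- Since `p` has degree below `d`, the partial sum of its first `d` terms at `c` is all of `p(c)`.
  rw [Nat.add_sub_cancel, coeff_of_mul_sub_X h n]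
  have : eval c p = fPoly (n + 1) x y (t + c) := by
    rw [← coe_evalRingHom, map_fPoly]
    simp
  rw [← this, eval_eq_sum_range' hdeg, Finset.mul_sum]
  exact Finset.sum_congr rfl fun j _ => by simp [mul_assoc]

end PowerSeriesLemmas

/-! ### Frobenius on `K` and nonvanishing of the Carlitz quantities. -/

section Frobenius

variable (Fq : Type*) [Field Fq] [Fintype Fq]

/-- The `q`-power map of `K = 𝔽_q(θ)`, `q = #𝔽_q`. -/
def frob : RatFunc Fq →+* RatFunc Fq := (FiniteField.frobeniusAlgHom Fq (RatFunc Fq)).toRingHom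

variable {Fq} {q : ℕ}

theorem frob_apply (hq : Fintype.card Fq = q) (b : RatFunc Fq) : frob Fq b = b ^ q := by
  subst hq
  rfl

theorem neg_one_pow_card (hq : Fintype.card Fq = q) : (-1 : RatFunc Fq) ^ q = -1 := by
  rw [← frob_apply hq, map_neg, map_one]

theorem theta_pow_injective (hq : Fintype.card Fq = q) {i j : ℕ}
    (h : theta Fq ^ q ^ i = theta Fq ^ q ^ j) : i = j := by
  have hq1 : 1 < q := hq ▸ Fintype.one_lt_card
  have h' : (Polynomial.X : Polynomial Fq) ^ q ^ i = Polynomial.X ^ q ^ j := by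
    apply RatFunc.algebraMap_injective Fq
    simpa [theta] using h
  have := congrArg Polynomial.natDegree h'
  rw [Polynomial.natDegree_X_pow, Polynomial.natDegree_X_pow] at this
  exact Nat.pow_right_injective hq1 this

theorem theta_pow_sub_ne_zero (hq : Fintype.card Fq = q) {i j : ℕ} (hij : i ≠ j) :
    theta Fq ^ q ^ i - theta Fq ^ q ^ j ≠ 0 :=
  sub_ne_zero.2 fun h => hij (theta_pow_injective hq h)

theorem theta_sub_pow_ne_zero (hq : Fintype.card Fq = q) {j : ℕ} (hj : j ≠ 0) :
    theta Fq - theta Fq ^ q ^ j ≠ 0 := by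
  simpa using theta_pow_sub_ne_zero hq hj.symm

theorem sub_pow_card (hq : Fintype.card Fq = q) (m : ℕ) (a b : RatFunc Fq) :
    (a - b) ^ q ^ m = a ^ q ^ m - b ^ q ^ m := by
  induction m with
  | zero => simp
  | succ m ih =>
    rw [pow_succ, pow_mul, pow_mul, pow_mul, ih, ← frob_apply hq, map_sub, frob_apply hq,
      frob_apply hq]

theorem bracket_ne_zero (hq : Fintype.card Fq = q) (m : ℕ) : bracket Fq q m ≠ 0 := by
  unfold bracket
  split_ifs with h
  · exact one_ne_zero
  · simpa using theta_pow_sub_ne_zero hq h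

theorem carlitzL_ne_zero (hq : Fintype.card Fq = q) (i : ℕ) : carlitzL Fq q i ≠ 0 := by
  induction i with
  | zero => exact one_ne_zero
  | succ i ih => exact mul_ne_zero (theta_sub_pow_ne_zero hq i.succ_ne_zero) ih

theorem carlitzD_ne_zero (hq : Fintype.card Fq = q) (i : ℕ) : carlitzD Fq q i ≠ 0 := by
  induction i with
  | zero => exact one_ne_zero
  | succ i ih => exact mul_ne_zero (bracket_ne_zero hq _) (pow_ne_zero _ ih)

end Frobenius

/-! ### The telescoping identity and the closed form of the scalar sum. -/

section Telescoping

variable (Fq : Type*) [Field Fq] (q d : ℕ)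

/-- The product `((x - θ^(q^(r+1))) ⋯ (x - θ^(q^(r+i)))) ^ d` in a ring `R` over `K`. -/
def rootProd {R : Type*} [CommRing R] (φ : RatFunc Fq →+* R) (r i : ℕ) (x : R) : R :=
  (∏ s ∈ Finset.Icc 1 i, (x - φ (theta Fq ^ q ^ (s + r)))) ^ d

/-- The scalar `(-1) ^ m D_m ^ (-d) l_{k-m} ^ (-d q ^ m)` for `m ≤ k`, and `0` for `m > k`. -/
def sumCoeff (k m : ℕ) : RatFunc Fq :=
  if m ≤ k then (-1) ^ m * (carlitzD Fq q m ^ d)⁻¹ * (carlitzL Fq q (k - m) ^ (d * q ^ m))⁻¹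
  else 0

/-- The `i`-th summand `b_{i,m} ^ q f_d(x, θ^(q^(i+1)), θ^(q^(m+1))) ∏ (x - θ^(q^s)) ^ d` of the
telescoping sum, where `b = sumCoeff`. -/
def summand {R : Type*} [CommRing R] (φ : RatFunc Fq →+* R) (m i : ℕ) (x : R) : R :=
  φ (sumCoeff Fq q d i m ^ q) *
    fPoly d x (φ (theta Fq ^ q ^ (i + 1))) (φ (theta Fq ^ q ^ (m + 1))) *
      rootProd Fq q d φ 0 i x

variable {Fq q d}

theorem carlitzL_eq_prod (i : ℕ) :
    carlitzL Fq q i = ∏ s ∈ Finset.Icc 1 i, (theta Fq - theta Fq ^ q ^ s) := by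
  induction i with
  | zero => simp [carlitzL]
  | succ i ih => rw [carlitzL, ih, Finset.prod_Icc_succ_top (by omega), mul_comm]

theorem bracket_succ (m : ℕ) : bracket Fq q (m + 1) = theta Fq ^ q ^ (m + 1) - theta Fq := by
  simp [bracket]

theorem lamMultiSum_zero (k : ℕ) : lamMultiSum Fq q d k 0 = 1 := by
  unfold lamMultiSum
  rw [sum_decreasingTuples_zero k fun i : Fin 0 → ℕ => ∏ r : Fin 0,
    lam Fq q d (i r) (0 - (r : ℕ)) ^ q ^ (r : ℕ)]
  simp

theorem theta_pow_pow (i : ℕ) : (theta Fq ^ q ^ i) ^ q = theta Fq ^ q ^ (i + 1) := by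
  rw [← pow_mul, ← pow_succ]

theorem rootProd_succ {R : Type*} [CommRing R] (φ : RatFunc Fq →+* R) (r i : ℕ) (x : R) :
    rootProd Fq q d φ r (i + 1) x =
      rootProd Fq q d φ r i x * (x - φ (theta Fq ^ q ^ (i + 1 + r))) ^ d := by
  rw [rootProd, Finset.prod_Icc_succ_top (by omega), mul_pow, rootProd]

theorem map_rootProd {R S : Type*} [CommRing R] [CommRing S] (φ : RatFunc Fq →+* R) (ψ : R →+* S)
    (r i : ℕ) (x : R) :
    ψ (rootProd Fq q d φ r i x) = rootProd Fq q d (ψ.comp φ) r i (ψ x) := by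
  simp [rootProd]

theorem map_summand {R S : Type*} [CommRing R] [CommRing S] (φ : RatFunc Fq →+* R) (ψ : R →+* S)
    (m i : ℕ) (x : R) : ψ (summand Fq q d φ m i x) = summand Fq q d (ψ.comp φ) m i (ψ x) := by
  simp [summand, map_rootProd, map_fPoly]

theorem rootProd_theta (i : ℕ) :
    rootProd Fq q d (RingHom.id _) 0 i (theta Fq) = carlitzL Fq q i ^ d := by
  rw [carlitzL_eq_prod]
  simp [rootProd]

variable [Fintype Fq]

theorem rootProd_comp_frob (hq : Fintype.card Fq = q) {R : Type*} [CommRing R]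
    (φ : RatFunc Fq →+* R) (r i : ℕ) (x : R) :
    rootProd Fq q d (φ.comp (frob Fq)) r i x = rootProd Fq q d φ (r + 1) i x := by
  simp only [rootProd, RingHom.comp_apply, frob_apply hq, theta_pow_pow, add_assoc]

theorem sumCoeff_succ_succ (hq : Fintype.card Fq = q) (k m : ℕ) :
    sumCoeff Fq q d (k + 1) (m + 1) * bracket Fq q (m + 1) ^ d = -sumCoeff Fq q d k m ^ q := by
  unfold sumCoeff
  have hq0 : q ≠ 0 := by
    rw [← hq]
    exact Fintype.card_ne_zero
  by_cases h : m ≤ k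
  · have hb := bracket_ne_zero hq (m + 1)
    have hD := carlitzD_ne_zero hq m
    have hl := carlitzL_ne_zero hq (k - m)
    have hs : ((-1 : RatFunc Fq) ^ m) ^ q = (-1) ^ m := by
      rw [← pow_mul, mul_comm, pow_mul, neg_one_pow_card hq]
    rw [if_pos h, if_pos (by omega), Nat.add_sub_add_right, carlitzD, mul_pow, mul_pow, mul_pow, hs]
    simp only [inv_pow, ← pow_mul]
    rw [show d * q ^ m * q = d * q ^ (m + 1) by ring, mul_comm q d]
    field_simp
    ring
  · rw [if_neg h, if_neg (by omega), zero_pow hq0]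
    simp

/-- For `k > m` this is the recursion for `l_{k-m}` raised to the power `d q^(m+1)`, because
`θ^(q^(m+1)) - θ^(q^(k+1))` is the `q^(m+1)`-th power of `θ - θ^(q^(k-m))`. For `k = m` the
difference vanishes, matching the convention `b_{m,m+1} = 0`. -/
theorem sumCoeff_mul_pow (hq : Fintype.card Fq = q) (hd : 1 ≤ d) (k m : ℕ) :
    sumCoeff Fq q d k m ^ q * (theta Fq ^ q ^ (m + 1) - theta Fq ^ q ^ (k + 1)) ^ d =
      -(sumCoeff Fq q d k (m + 1) * bracket Fq q (m + 1) ^ d) := by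
  have hq0 : q ≠ 0 := by
    rw [← hq]
    exact Fintype.card_ne_zero
  rcases lt_trichotomy k m with h | rfl | h
  · simp [sumCoeff, show ¬ m ≤ k by omega, show ¬ m + 1 ≤ k by omega, hq0]
  · simp [sumCoeff, show d ≠ 0 by omega]
  · obtain ⟨k, rfl⟩ : ∃ n, k = n + 1 := ⟨k - 1, by omega⟩
    rw [sumCoeff_succ_succ hq, neg_neg]
    obtain ⟨n, rfl⟩ : ∃ n, k = n + m := ⟨k - m, by omega⟩
    have hl := carlitzL_ne_zero hq n
    have ht := theta_sub_pow_ne_zero hq n.succ_ne_zero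
    have e : theta Fq ^ q ^ (m + 1) - theta Fq ^ q ^ (n + m + 1 + 1) =
        (theta Fq - theta Fq ^ q ^ (n + 1)) ^ q ^ (m + 1) := by
      rw [sub_pow_card hq, ← pow_mul, ← pow_add]
      congr 3
      ring
    have hl' : carlitzL Fq q (n + 1) =
      (theta Fq - theta Fq ^ q ^ (n + 1)) * carlitzL Fq q n := rfl
    simp only [sumCoeff, if_pos (show m ≤ n + m + 1 by omega), if_pos (show m ≤ n + m by omega),
      show n + m + 1 - m = n + 1 by omega, Nat.add_sub_cancel]
    rw [e, hl']
    simp only [mul_pow, inv_pow, ← pow_mul]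
    rw [show q ^ (m + 1) * d = d * q ^ m * q by ring]
    field_simp

theorem sub_mul_sum_summand (hq : Fintype.card Fq = q) (hd : 1 ≤ d) {R : Type*} [CommRing R]
    (φ : RatFunc Fq →+* R) (m k : ℕ) (x : R) :
    (φ (theta Fq ^ q ^ (m + 1)) - x) * ∑ i ∈ Finset.range k, summand Fq q d φ m i x =
      φ (sumCoeff Fq q d k (m + 1) * bracket Fq q (m + 1) ^ d) * rootProd Fq q d φ 0 k x := by
  induction k with
  | zero => simp [sumCoeff]
  | succ k ih =>
    rw [Finset.sum_range_succ, mul_add, ih, sumCoeff_succ_succ hq, rootProd_succ, summand]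
    have h1 := fPoly_mul d x (φ (theta Fq ^ q ^ (k + 1))) (φ (theta Fq ^ q ^ (m + 1)))
    have h2 := congrArg φ (sumCoeff_mul_pow hq hd k m)
    simp only [map_mul, map_neg, map_sub, map_pow, add_zero] at h1 h2 ⊢
    -- `h1` splits the new term into a `(z - y)^d` part, which cancels the old right side by `h2`,
    -- and a `(x - y)^d` part, which extends `P_k` to `P_{k+1}`.
    linear_combination (φ (sumCoeff Fq q d k m) ^ q * rootProd Fq q d φ 0 k x) * h1 +
      rootProd Fq q d φ 0 k x * h2

theorem sum_summand_theta (hq : Fintype.card Fq = q) (hd : 1 ≤ d) (m k : ℕ) :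
    ∑ i ∈ Finset.range k, summand Fq q d (RingHom.id _) m i (theta Fq) =
      sumCoeff Fq q d k (m + 1) * bracket Fq q (m + 1) ^ (d - 1) * carlitzL Fq q k ^ d := by
  have h := sub_mul_sum_summand hq hd (RingHom.id _) m k (theta Fq)
  obtain ⟨n, rfl⟩ : ∃ n, d = n + 1 := ⟨d - 1, by omega⟩
  rw [rootProd_theta, RingHom.id_apply, ← bracket_succ] at h
  apply mul_left_cancel₀ (bracket_ne_zero hq (m + 1))
  rw [h, RingHom.id_apply, Nat.add_sub_cancel]
  ring

theorem lamMultiSum_succ (hq : Fintype.card Fq = q) (k m : ℕ) :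
    lamMultiSum Fq q d k (m + 1) =
      ∑ i ∈ Finset.range k, lam Fq q d i (m + 1) * lamMultiSum Fq q d i m ^ q := by
  unfold lamMultiSum
  rw [sum_decreasingTuples_succ k m fun i : Fin (m + 1) → ℕ => ∏ r : Fin (m + 1),
    lam Fq q d (i r) (m + 1 - (r : ℕ)) ^ q ^ (r : ℕ)]
  refine Finset.sum_congr rfl fun n _ => ?_
  rw [← frob_apply hq, map_sum, Finset.mul_sum]
  refine Finset.sum_congr rfl fun j _ => ?_
  rw [Fin.prod_univ_succ, map_prod]
  simp [frob_apply hq, pow_succ, pow_mul]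

/-- The exponents in `λ_{i,m+1}` are designed for this: the powers of `[m]` cancel and those of
`l_i` combine to `l_i^d = P_i(θ)`. -/
theorem lam_mul_pow (hq : Fintype.card Fq = q) (hd : 1 ≤ d) (i m : ℕ) :
    lam Fq q d i (m + 1) *
        (sumCoeff Fq q d i m * bracket Fq q m ^ (d - 1) * carlitzL Fq q i ^ d) ^ q =
      summand Fq q d (RingHom.id _) m i (theta Fq) := by
  have hl := carlitzL_ne_zero hq i
  have hb := bracket_ne_zero hq m
  obtain ⟨n, rfl⟩ : ∃ n, d = n + 1 := ⟨d - 1, by omega⟩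
  have e1 : bracket Fq q m ^ ((1 - ((n + 1 : ℕ) : ℤ)) * (q : ℤ)) =
      (bracket Fq q m ^ (n * q))⁻¹ := by
    rw [← zpow_natCast, ← zpow_neg]
    congr 1
    push_cast
    ring
  have e2 : carlitzL Fq q i ^ (((n + 1 : ℕ) : ℤ) * (1 - (q : ℤ))) =
      carlitzL Fq q i ^ (n + 1) * (carlitzL Fq q i ^ ((n + 1) * q))⁻¹ := by
    rw [← zpow_natCast, ← zpow_natCast, ← zpow_neg, ← zpow_add₀ hl]
    congr 1
    push_cast
    ring
  rw [lam, Nat.add_sub_cancel, e1, e2, summand, rootProd_theta]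
  simp only [Nat.add_sub_cancel, mul_pow, ← pow_mul, RingHom.id_apply]
  field_simp

theorem lamMultiSum_eq (hq : Fintype.card Fq = q) (hd : 1 ≤ d) (k m : ℕ) :
    lamMultiSum Fq q d k m =
      sumCoeff Fq q d k m * bracket Fq q m ^ (d - 1) * carlitzL Fq q k ^ d := by
  induction m generalizing k with
  | zero => simp [lamMultiSum_zero, sumCoeff, bracket, carlitzD, carlitzL_ne_zero hq]
  | succ m ih =>
    rw [lamMultiSum_succ hq, ← sum_summand_theta hq hd]
    exact Finset.sum_congr rfl fun i _ => by rw [ih, lam_mul_pow hq hd]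

end Telescoping

/-! ### The matrix sum -/

section Matrices

variable {Fq : Type*} [Field Fq] {q d : ℕ}

theorem matMultiSum_zero (k : ℕ) : matMultiSum Fq q d k 0 = 1 := by
  unfold matMultiSum
  rw [sum_decreasingTuples_zero k fun i : Fin 0 → ℕ =>
    (List.ofFn fun r : Fin 0 => twist q (r : ℕ) (matL Fq q d (i r))).prod]
  simp

theorem rootL_eq_div (i : ℕ) :
    rootL Fq q d i =
      algebraMap _ _ (fPoly d (MvPolynomial.X 0) (MvPolynomial.X 1) (MvPolynomial.X 2) *
        rootProd Fq q d (MvPolynomial.C (σ := Fin 3)) 0 i (MvPolynomial.X 0)) /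
      algebraMap _ _ (rootProd Fq q d (MvPolynomial.C (σ := Fin 3)) 1 i (MvPolynomial.X 2)) := by
  rw [map_mul, map_fPoly]
  simp only [rootL, rootProd, map_pow, map_prod, map_sub, div_pow, mul_div_assoc]
  simp only [ratX, ratC, map_pow, add_zero]

variable [Fintype Fq]

open PowerSeries in
/-- The entries of `𝓛_i` as coefficients of a power series in `T` over `K[[X]]`, the expansion at
`x = θ + X`, `z = θ ^ q + T` of the function defining `𝓛_i`. -/
theorem exists_matL_expansion (hq : Fintype.card Fq = q) (i : ℕ) :
    ∃ Φ : PowerSeries (PowerSeries (RatFunc Fq)),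
      Φ * PowerSeries.map C (rootProd Fq q d C 1 i (C (theta Fq ^ q) + X)) =
        C (rootProd Fq q d C 0 i (C (theta Fq) + X)) *
          fPoly d (C (C (theta Fq) + X)) (C (C (theta Fq ^ q ^ (i + 1))))
            (C (C (theta Fq ^ q)) + X) ∧
      ∀ a b : Fin d, matL Fq q d i a b = coeff (d - 1 - a) (coeff b Φ) := by
  obtain ⟨Φ, h1, h2⟩ := exists_expansion
    ![theta Fq, theta Fq ^ q ^ (i + 1), theta Fq ^ q] 0 2
    (fPoly d (MvPolynomial.X 0) (MvPolynomial.X 1) (MvPolynomial.X 2) *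
        rootProd Fq q d MvPolynomial.C 0 i (MvPolynomial.X 0))
    (rootProd Fq q d MvPolynomial.C 1 i (MvPolynomial.X 2)) (by
      rw [map_rootProd]
      refine pow_ne_zero _ (Finset.prod_ne_zero_iff.2 fun s hs => ?_)
      have := Finset.mem_Icc.1 hs
      have := theta_pow_sub_ne_zero hq (Fq := Fq) (show 1 ≠ s + 1 by omega)
      simpa using this)
  refine ⟨Φ, ?_, fun a b => ?_⟩
  · have hX : ∀ u, expandAt ![theta Fq, theta Fq ^ q ^ (i + 1), theta Fq ^ q] 0 2
        (MvPolynomial.X u) = PowerSeries.C (PowerSeries.C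
          (![theta Fq, theta Fq ^ q ^ (i + 1), theta Fq ^ q] u) +
            if u = 0 then PowerSeries.X else 0) + if u = 2 then PowerSeries.X else 0 :=
      fun u => MvPolynomial.eval₂_X _ _ _
    have hC : (expandAt ![theta Fq, theta Fq ^ q ^ (i + 1), theta Fq ^ q] 0 2).comp
        MvPolynomial.C = (C : PowerSeries (RatFunc Fq) →+* _).comp C := by
      ext c : 1
      exact MvPolynomial.eval₂_C _ _ _
    have hC' : (PowerSeries.map (C : RatFunc Fq →+* _)).comp C =
        (C : PowerSeries (RatFunc Fq) →+* _).comp C := by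
      ext c : 1
      simp
    rw [map_mul, map_fPoly, map_rootProd, map_rootProd, hC, hX, hX, hX] at h1
    -- The denominator involves only `z`, so its expansion has coefficients constant in `X`.
    rw [map_rootProd, map_rootProd, hC', mul_comm (rootProd _ _ _ _ _ _ _)]
    simpa using h1
  · rw [← h2, matL, Matrix.map_apply, deltaMatrix, Matrix.of_apply, rootL_eq_div]

theorem twist_succ (hq : Fintype.card Fq = q) (r : ℕ) (M : Matrix (Fin d) (Fin d) (RatFunc Fq)) :
    twist q (r + 1) M = (twist q r M).map (frob Fq) := by
  ext a b
  simp [twist, frob_apply hq, pow_succ, pow_mul]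

theorem matMultiSum_succ (hq : Fintype.card Fq = q) (k m : ℕ) :
    matMultiSum Fq q d k (m + 1) =
      ∑ i ∈ Finset.range k, matL Fq q d i * (matMultiSum Fq q d i m).map (frob Fq) := by
  unfold matMultiSum
  rw [sum_decreasingTuples_succ k m fun i : Fin (m + 1) → ℕ =>
    (List.ofFn fun r : Fin (m + 1) => twist q (r : ℕ) (matL Fq q d (i r))).prod]
  refine Finset.sum_congr rfl fun n _ => ?_
  rw [← RingHom.mapMatrix_apply, map_sum, Finset.mul_sum]
  refine Finset.sum_congr rfl fun j _ => ?_
  have h0 : ∀ M : Matrix (Fin d) (Fin d) (RatFunc Fq), twist q 0 M = M := fun M => by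
    ext a b
    simp [twist]
  rw [List.ofFn_succ, List.prod_cons, map_list_prod, List.map_ofFn]
  simp [h0, twist_succ hq, Function.comp_def]

open PowerSeries in
/-- The product of a matrix given by the coefficients of `Φ` and the column given by the
coefficients of `W`. -/
theorem sum_coeff_mul_coeff {R : Type*} [CommRing R] {d : ℕ} (hd : 1 ≤ d) (n : ℕ)
    (Φ : PowerSeries (PowerSeries R)) (W : PowerSeries R) :
    ∑ b : Fin d, coeff n (coeff b Φ) * coeff (d - 1 - b) W =
      coeff n (coeff (d - 1) (Φ * PowerSeries.map C W)) := by
  obtain ⟨e, rfl⟩ : ∃ e, d = e + 1 := ⟨d - 1, by omega⟩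
  rw [Nat.add_sub_cancel, coeff_mul, map_sum, Finset.Nat.sum_antidiagonal_eq_sum_range_succ_mk,
    Finset.sum_range]
  simp [coeff_mul_C]

open PowerSeries in
/-- The expansion at `x = θ` of the summand of the telescoping sum. -/
abbrev summandSeries (Fq : Type*) [Field Fq] (q d m i : ℕ) : PowerSeries (RatFunc Fq) :=
  summand Fq q d C m i (C (theta Fq) + X)

open PowerSeries in
theorem map_frob_rootProd (hq : Fintype.card Fq = q) (i : ℕ) :
    PowerSeries.map (frob Fq) (rootProd Fq q d C 0 i (C (theta Fq) + X)) =
      rootProd Fq q d C 1 i (C (theta Fq ^ q) + X) := by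
  have h : (PowerSeries.map (frob Fq)).comp C = C.comp (frob Fq) := by
    ext c : 1
    simp
  rw [map_rootProd, h, rootProd_comp_frob hq]
  simp [frob_apply hq]

-- No `z`-derivative is taken in the first column: at `z = θ^q` the denominator becomes `l_i^(dq)`,
-- whose inverse is `b_{i,0}^q`. This starts the induction.
open PowerSeries in
theorem matL_apply_zero (hq : Fintype.card Fq = q) (hd : 1 ≤ d) (i : ℕ) (a : Fin d) :
    matL Fq q d i a ⟨0, hd⟩ = coeff (d - 1 - a) (summandSeries Fq q d 0 i) := by
  obtain ⟨Φ, h1, h2⟩ := exists_matL_expansion (d := d) hq i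
  have hl := carlitzL_ne_zero hq i
  have h3 := congrArg constantCoeff h1
  have h4 : constantCoeff (PowerSeries.map C (rootProd Fq q d C 1 i (C (theta Fq ^ q) + X))) =
      C ((carlitzL Fq q i ^ d) ^ q) := by
    have h : (constantCoeff (R := RatFunc Fq)).comp C = RingHom.id _ := by
      ext c : 1
      simp
    rw [← coeff_zero_eq_constantCoeff_apply, coeff_map, coeff_zero_eq_constantCoeff_apply,
      ← map_frob_rootProd hq, ← coeff_zero_eq_constantCoeff_apply, coeff_map,
      coeff_zero_eq_constantCoeff_apply, map_rootProd, h]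
    simp [rootProd_theta, frob_apply hq]
  rw [map_mul, map_mul, h4, map_fPoly] at h3
  have h5 : constantCoeff Φ = summandSeries Fq q d 0 i := by
    have hC : (C ((carlitzL Fq q i ^ d) ^ q) : PowerSeries (RatFunc Fq)) *
        C (((carlitzL Fq q i ^ d) ^ q)⁻¹) = 1 := by
      rw [← map_mul, mul_inv_cancel₀ (pow_ne_zero _ (pow_ne_zero _ hl)), map_one]
    have h6 : sumCoeff Fq q d i 0 ^ q = ((carlitzL Fq q i ^ d) ^ q)⁻¹ := by
      simp [sumCoeff, carlitzD]
    rw [summandSeries, summand, h6, ← mul_one (constantCoeff Φ), ← hC, ← mul_assoc, h3]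
    simp
    ring
  rw [h2, ← h5, coeff_zero_eq_constantCoeff_apply]

-- The induction step on columns: `𝓛_i` turns the twist of `S_{m,i}` into the `i`-th summand of
-- `S_{m+1,k}`.
open PowerSeries in
theorem sum_matL_mul_frob (hq : Fintype.card Fq = q) (hd : 1 ≤ d) (m i : ℕ) (a : Fin d) :
    ∑ b : Fin d, matL Fq q d i a b *
        frob Fq (coeff (d - 1 - b) (∑ j ∈ Finset.range i, summandSeries Fq q d m j)) =
      coeff (d - 1 - a) (summandSeries Fq q d (m + 1) i) := by
  obtain ⟨Φ, h1, h2⟩ := exists_matL_expansion (d := d) hq i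
  have hb := pow_ne_zero d (pow_ne_zero q (bracket_ne_zero (Fq := Fq) hq (m + 1)))
  set S := ∑ j ∈ Finset.range i, summandSeries Fq q d m j with hS
  set W := PowerSeries.map (frob Fq) S with hW
  have hb' : bracket Fq q (m + 1) ^ q = theta Fq ^ q ^ (m + 2) - theta Fq ^ q := by
    rw [bracket_succ, ← frob_apply hq, map_sub, frob_apply hq, frob_apply hq, theta_pow_pow]
  -- The telescoping identity, twisted. Frobenius acts on coefficients only, so the expansion point
  -- `θ` moves to `θ^q` and `c = [m+1]^q` appears.
  have h3 : W * (C (bracket Fq q (m + 1) ^ q) - X) =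
      C ((sumCoeff Fq q d i (m + 1) * bracket Fq q (m + 1) ^ d) ^ q) *
        rootProd Fq q d C 1 i (C (theta Fq ^ q) + X) := by
    have h := congrArg (PowerSeries.map (frob Fq))
      (sub_mul_sum_summand hq hd C m i (C (theta Fq) + X))
    rw [map_mul, map_mul, map_frob_rootProd hq, map_C, frob_apply hq] at h
    rw [← h, mul_comm W, hW, hS, hb']
    congr 1
    simp only [map_sub, map_add, map_C, map_X, frob_apply hq, theta_pow_pow]
    ring
  have h4 := coeff_of_mul_sub_X_eq_fPoly (R := PowerSeries (RatFunc Fq)) hd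
    (Q := Φ * PowerSeries.map C W) (c := C (bracket Fq q (m + 1) ^ q))
    (x := C (theta Fq) + X) (y := C (theta Fq ^ q ^ (i + 1))) (t := C (theta Fq ^ q))
    (e := C ((sumCoeff Fq q d i (m + 1) * bracket Fq q (m + 1) ^ d) ^ q) *
      rootProd Fq q d C 0 i (C (theta Fq) + X)) (by
        have h := congrArg (PowerSeries.map (C : RatFunc Fq →+* _)) h3
        simp only [map_mul, map_sub, map_C, map_X] at h h1 ⊢
        rw [mul_assoc, h]
        linear_combination (C (C ((sumCoeff Fq q d i (m + 1) * bracket Fq q (m + 1) ^ d) ^ q))) * h1)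
  have h5 : coeff (d - 1) (Φ * PowerSeries.map C W) = summandSeries Fq q d (m + 1) i := by
    have hC : (C ((bracket Fq q (m + 1) ^ q) ^ d) : PowerSeries (RatFunc Fq)) ≠ 0 := by
      rwa [Ne, map_eq_zero_iff _ C_injective]
    apply mul_left_cancel₀ hC
    -- Here `θ^q + c = θ^(q^(m+2))`, the last argument of `f_d` in the next summand; `c^d` cancels
    -- against `[m+1]^(dq)`.
    rw [map_pow, h4, ← map_add, hb', add_sub_cancel, summandSeries, summand, ← hb']
    simp only [map_mul, map_pow]
    ring
  simp only [h2, ← coeff_map, ← hW]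
  rw [sum_coeff_mul_coeff hd, h5]

open PowerSeries in
theorem matMultiSum_succ_apply (hq : Fintype.card Fq = q) (hd : 1 ≤ d) (k m : ℕ) (a : Fin d) :
    matMultiSum Fq q d k (m + 1) a ⟨0, hd⟩ =
      coeff (d - 1 - a) (∑ i ∈ Finset.range k, summandSeries Fq q d m i) := by
  induction m generalizing k a with
  | zero =>
    simp only [matMultiSum_succ hq, matMultiSum_zero, Matrix.map_one _ (map_zero _) (map_one _),
      mul_one, Matrix.sum_apply, map_sum, matL_apply_zero hq hd]
  | succ m ih =>
    rw [matMultiSum_succ hq, Matrix.sum_apply, map_sum]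
    refine Finset.sum_congr rfl fun i _ => ?_
    rw [← sum_matL_mul_frob hq hd, Matrix.mul_apply]
    simp only [Matrix.map_apply, ih]

end Matrices

end

end CarlitzTensor

theorem mainTheorem4 {Fq : Type*} [Field Fq] [Fintype Fq] (q : ℕ) (hq : Fintype.card Fq = q)
    (d : ℕ) (hd : 1 ≤ d) (k m : ℕ) (hm : 1 ≤ m) (hmk : m ≤ k) :
    CarlitzTensor.matMultiSum Fq q d k m ⟨d - 1, by omega⟩ ⟨0, by omega⟩ =
        CarlitzTensor.lamMultiSum Fq q d k m ∧
      CarlitzTensor.lamMultiSum Fq q d k m =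
        (-1) ^ m * CarlitzTensor.carlitzL Fq q k ^ d *
          CarlitzTensor.bracket Fq q m ^ (d - 1) *
          CarlitzTensor.carlitzD Fq q m ^ (-(d : ℤ)) *
          CarlitzTensor.carlitzL Fq q (k - m) ^ (-((d : ℤ) * (q : ℤ) ^ m)) := by
  constructor
  · obtain ⟨m, rfl⟩ : ∃ n, m = n + 1 := ⟨m - 1, by omega⟩
    -- Row `d` picks out the constant coefficient, that is, the value at `x = θ`.
    rw [CarlitzTensor.matMultiSum_succ_apply hq hd, CarlitzTensor.lamMultiSum_eq hq hd,
      ← CarlitzTensor.sum_summand_theta hq hd, Nat.sub_self,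
      PowerSeries.coeff_zero_eq_constantCoeff_apply, map_sum]
    refine Finset.sum_congr rfl fun i _ => ?_
    rw [CarlitzTensor.map_summand]
    congr 1
    simp
  · rw [CarlitzTensor.lamMultiSum_eq hq hd, CarlitzTensor.sumCoeff, if_pos hmk, zpow_neg,
      zpow_neg, ← Nat.cast_pow, ← Nat.cast_mul, zpow_natCast, zpow_natCast]
    ring
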